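/- Let $G$ be an infinite planar graph (an undirected simple graph that can be drawn in the plane without crossings, the edges being simple arcs), let $x_0$ be a node of $G$, and for $n\ge 0$ let $G_n=B(x_0,n)$ be the subgraph of $G$ induced on the nodes at graph distance at most $n$ from $x_0$. Suppose that every $G_n$ is finite and that $G$ has exponential growth, that is, there are $\lambda>1$ and $n_0$ such that $|G_n|\ge\lambda^n$ for all $n\ge n_0$. A routing $R$ of $G_n$ carries one unit of demand between every unordered pair of distinct nodes of $G_n$, where the unit of each pair may be split arbitrarily among finitely many walks inside $G_n$ that join the two nodes. The load $T_n(v)$ of a node $v$ under $R$ is the total amount of demand, over all pairs, that is carried by walks containing $v$ (as an end or as an inner node). Then there is a constant $C>0$, independent of $n$ and of the routing, such that for all sufficiently large $n$ and for every routing $R$ of $G_n$ there is a node $v$ of $G_n$ with $$T_n(v)\;\ge\; C\,\frac{N^2}{\log N},\qquad N=|G_n|.$$ -/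

import Mathlib

open Filter

namespace CongestionPlanar

/-- A drawing of the graph `G` in the plane without crossings: distinct vertices are distinct points,
every edge is a simple arc joining the points of its two ends, the interior of an arc contains no
vertex, and the interiors of the arcs of two distinct edges are disjoint. -/
structure PlaneDrawing {V : Type*} (G : SimpleGraph V) where
  /-- the point of the plane that represents a vertex -/
  point : V → ℂ
  /-- the arc that represents an edge, with a parametrization by the unit interval -/
  arc : G.edgeSet → C(unitInterval, ℂ)
  point_injective : Function.Injective point
  arc_injective : ∀ e, Function.Injective (arc e)
  arc_ends : ∀ e : G.edgeSet, s(arc e 0, arc e 1) = Sym2.map point (e : Sym2 V)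
  arc_ne_point : ∀ e, ∀ t ∈ Set.Ioo (0 : unitInterval) 1, ∀ v, arc e t ≠ point v
  arc_disjoint : ∀ e f, e ≠ f → ∀ s ∈ Set.Ioo (0 : unitInterval) 1,
    ∀ t ∈ Set.Ioo (0 : unitInterval) 1, arc e s ≠ arc f t

/-- A graph is planar if it can be drawn in the plane without crossings. -/
def IsPlanar {V : Type*} (G : SimpleGraph V) : Prop :=
  Nonempty (PlaneDrawing G)

/-- The ball `B(x₀, n)`: all nodes at graph distance at most `n` from `x₀`. The extended distance is
used, so that a node that cannot be reached from `x₀` lies in no ball. -/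
def nodeBall {V : Type*} (G : SimpleGraph V) (x₀ : V) (n : ℕ) : Set V :=
  {y | G.edist x₀ y ≤ n}

/-- The network `G_n`: the subgraph of `G` induced on the ball `B(x₀, n)`. -/
abbrev ballGraph {V : Type*} (G : SimpleGraph V) (x₀ : V) (n : ℕ) :
    SimpleGraph (nodeBall G x₀ n) :=
  G.induce (nodeBall G x₀ n)

/-- Exponential growth from the root `x₀`: for some `λ > 1`, the inequality `|B(x₀, n)| ≥ λ ^ n`
holds for all sufficiently large `n`. -/
def HasExponentialGrowth {V : Type*} (G : SimpleGraph V) (x₀ : V) : Prop :=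
  ∃ (n₀ : ℕ) (lam : ℝ), 1 < lam ∧ ∀ n : ℕ, n₀ ≤ n → lam ^ n ≤ ((nodeBall G x₀ n).ncard : ℝ)

/-- A routing in the network `H` of one unit of demand between every pair of distinct nodes. The unit
of a pair may be split in any way among finitely many walks of `H` between the two nodes, and
`amount s t p` is the part that follows the walk `p`. Pairs are unordered: a walk from `s` to `t` and
its reverse describe the same route, which is what `symm` says. -/
structure Routing {W : Type*} (H : SimpleGraph W) where
  amount : ∀ s t : W, H.Walk s t →₀ ℝ
  nonneg : ∀ s t p, 0 ≤ amount s t p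
  total : ∀ s t, s ≠ t → ((amount s t).sum fun _ a => a) = 1
  symm : ∀ s t p, amount t s p.reverse = amount s t p

open Classical in
/-- The load of a node `v`: the total flow along routes that contain `v`, the ends of a route
included. Every unordered pair of nodes occurs in both orders in the sum, hence the factor `1 / 2`. -/
noncomputable def Routing.load {W : Type*} [Fintype W] {H : SimpleGraph W} (R : Routing H) (v : W) :
    ℝ :=
  (1 / 2) * ∑ q ∈ (Finset.univ : Finset W).offDiag,
    (R.amount q.1 q.2).sum fun p a => if v ∈ p.support then a else 0

end CongestionPlanar

/-!
A plane graph in which every vertex is within distance `n` of a root has a balanced separator of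
only `O(n)` vertices (`PlaneDrawing.exists_separator`). A constant proportion of all pairs of nodes
is split by it, so the nodes of the separator carry a total load of order `N ^ 2`, and one of them
carries a load of order `N ^ 2 / n` (`PlaneDrawing.exists_load_ge`). By exponential
growth, `n` is of order at most `log N`.

The separator theorem is proved without faces or the Jordan curve theorem, by a cocycle argument
with winding numbers. Every point `z` of the plane is joined to the root `o` by a path that runs
along a segment to the nearest point of the drawing, then to a vertex, then along a shortest path
of the graph; all edges it touches have an end in a set of at most `n + 3` vertices. Continuing the
logarithm of `(z - v) / (o - v)` along this path gives a value `θ_z v` for every other vertex `v`,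
and these values vary continuously along the edges that avoid the exceptional set
(`PlaneDrawing.exists_isLogBranch`). For two nearby points `a` and `b` the difference of `θ_a` and
`θ_b`, corrected by the logarithm of `(b - v) / (a - v)`, takes values in `2πiℤ`. It is therefore
constant along the edges outside the two exceptional sets and two more vertices that cover a small
disc (`PlaneDrawing.transition_eq_of_adj`): its level sets are separated from each other by `O(n)`
vertices.

If no such separator is balanced, then every pair of nearby points has one transition value that is
taken by more than three quarters of the vertices. Around a small quadrilateral the four majorities
have a common vertex, at which the transitions add up to zero, so the majority values form a
cocycle on a fine polar grid. On the innermost ring all points coincide and the cocycle vanishes.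
On the outermost ring, which surrounds the drawing, all paths are continuations of a single one
along the circle, so the cocycle vanishes there too, but after a full turn the branch has changed
by `2πi`. Hence the sums of the cocycle over the first and the last ray differ by `2πi`
(`polarGrid` does not identify these rays), which contradicts `sum_eq_sum_of_cocycle`.
-/

namespace CongestionPlanar

open Complex (exp log)
open scoped unitInterval

/-! ### Continuous logarithms -/

/-- A continuous function without zeros on a simply connected space has a continuous logarithm. -/
theorem exists_continuous_log {X : Type*} [TopologicalSpace X] [SimplyConnectedSpace X]
    [LocallyPathConnectedSpace X] (f : C(X, ℂ)) (hf : ∀ x, f x ≠ 0) :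
    ∃ F : C(X, ℂ), ∀ x, exp (F x) = f x := by
  obtain ⟨x₀⟩ : Nonempty X := inferInstance
  obtain ⟨F, ⟨-, hF⟩, -⟩ := Complex.isCoveringMapOn_exp.existsUnique_continuousMap_lifts f
    (a₀ := x₀) (Complex.exp_log (hf x₀)) (fun x => hf x)
  exact ⟨F, fun x => congrFun hF x⟩

theorem eq_of_continuous_of_exp_eq_one {X : Type*} [TopologicalSpace X] [PreconnectedSpace X]
    {g : X → ℂ} (hg : Continuous g) (h : ∀ x, exp (g x) = 1) (x y : X) : g x = g y := by
  have := Complex.isCoveringMap_exp.eq_of_comp_eq (g₁ := g) (g₂ := fun _ => g y) hg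
    continuous_const (by ext x; simp [h]) y rfl
  exact congrFun this x

theorem eq_zero_of_exp_eq_one_of_abs_im_lt {z : ℂ} (h : exp z = 1)
    (him : |z.im| < 2 * Real.pi) : z = 0 := by
  obtain ⟨n, rfl⟩ := Complex.exp_eq_one_iff.1 h
  have h1 : ((n : ℂ) * (2 * Real.pi * Complex.I)).im = n * (2 * Real.pi) := by simp
  rw [h1, abs_mul, abs_of_pos Real.two_pi_pos] at him
  have h2 : |(n : ℝ)| < 1 := by
    by_contra hn
    nlinarith [Real.two_pi_pos]
  have h3 : n = 0 := by
    rw [← Int.cast_abs] at h2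
    exact Int.abs_lt_one_iff.1 (by exact_mod_cast h2)
  simp [h3]

theorem abs_log_im_lt_pi_div_two {z : ℂ} (hz : 0 < z.re) : |(log z).im| < Real.pi / 2 := by
  rw [Complex.log_im]
  exact Complex.abs_arg_lt_pi_div_two_iff.2 (Or.inl hz)

open Classical in
/-- The change of a continuous logarithm of `γ s - a` as `s` runs along the path `γ`, which must
avoid `a` (the value is `0` otherwise). It does not depend on the choice of the logarithm. -/
noncomputable def logChange (γ : C(I, ℂ)) (a : ℂ) : ℂ :=
  if h : ∃ F : C(ℝ, ℂ), ∀ x, exp (F x) = γ (Set.projIcc 0 1 zero_le_one x) - a then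
    h.choose 1 - h.choose 0
  else 0

theorem logChange_eq {γ : C(I, ℂ)} {a : ℂ} {F : ℝ → ℂ} (hF : Continuous F)
    (h : ∀ x, exp (F x) = γ (Set.projIcc 0 1 zero_le_one x) - a) :
    logChange γ a = F 1 - F 0 := by
  have hex : ∃ F : C(ℝ, ℂ), ∀ x, exp (F x) = γ (Set.projIcc 0 1 zero_le_one x) - a :=
    ⟨⟨F, hF⟩, h⟩
  rw [logChange, dif_pos hex]
  have := eq_of_continuous_of_exp_eq_one (g := fun x => hex.choose x - F x) (by fun_prop)
    (fun x => by
      rw [Complex.exp_sub, hex.choose_spec x, ← h x, div_self (Complex.exp_ne_zero _)]) 1 0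
  linear_combination this

theorem exp_logChange {γ : C(I, ℂ)} {a : ℂ} (h : ∀ s, γ s ≠ a) :
    exp (logChange γ a) = (γ 1 - a) / (γ 0 - a) := by
  obtain ⟨F, hF⟩ := exists_continuous_log
    (⟨fun x : ℝ => γ (Set.projIcc 0 1 zero_le_one x) - a, by fun_prop⟩ : C(ℝ, ℂ))
    (fun x => sub_ne_zero.2 (h _))
  rw [logChange_eq F.continuous hF, Complex.exp_sub, hF, hF]
  simp

/-- The change of the logarithm along a path depends continuously on the centre. -/
theorem continuous_logChange_comp (γ e : C(I, ℂ)) (h : ∀ s t, γ s ≠ e t) :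
    Continuous fun t => logChange γ (e t) := by
  obtain ⟨F, hF⟩ := exists_continuous_log
    (⟨fun x : ℝ × ℝ => γ (Set.projIcc 0 1 zero_le_one x.1) -
      e (Set.projIcc 0 1 zero_le_one x.2), by fun_prop⟩ : C(ℝ × ℝ, ℂ))
    (fun x => sub_ne_zero.2 (h _ _))
  have : ∀ t : I, logChange γ (e t) = F (1, t) - F (0, t) := fun t =>
    logChange_eq (F := fun x => F (x, t)) (by fun_prop) (fun x => by rw [hF]; simp)
  simp_rw [this]
  fun_prop

/-! ### Cells of a drawing and covers -/

namespace PlaneDrawing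

variable {W : Type*} {H : SimpleGraph W}

/-- The restriction of a drawing to an induced subgraph. -/
def induce (D : PlaneDrawing H) (s : Set W) : PlaneDrawing (H.induce s) where
  point v := D.point v
  arc e := D.arc ((SimpleGraph.Embedding.induce s).mapEdgeSet e)
  point_injective := D.point_injective.comp Subtype.val_injective
  arc_injective e := D.arc_injective _
  arc_ends e := by
    rw [D.arc_ends]
    exact Sym2.map_map _
  arc_ne_point e t ht v := D.arc_ne_point _ t ht v
  arc_disjoint e f hef := D.arc_disjoint _ _
    (fun h => hef ((SimpleGraph.Embedding.induce s).mapEdgeSet.injective h))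

/-- The pieces of a drawing: the points of the vertices and the closed arcs of the edges. -/
def cell (D : PlaneDrawing H) : W ⊕ H.edgeSet → Set ℂ
  | .inl v => {D.point v}
  | .inr e => Set.range (D.arc e)

open Classical in
/-- The vertices at which a piece of a drawing ends. -/
noncomputable def cellEnds : W ⊕ H.edgeSet → Finset W
  | .inl v => {v}
  | .inr e => (e : Sym2 W).toFinset

theorem card_cellEnds_le (q : W ⊕ H.edgeSet) : (cellEnds q).card ≤ 2 := by
  classical
  rcases q with v | e
  · simp [cellEnds]
  · simp only [cellEnds, Sym2.card_toFinset]
    split_ifs <;> omega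

theorem cellEnds_nonempty (q : W ⊕ H.edgeSet) : (cellEnds q).Nonempty := by
  classical
  rcases q with v | ⟨e, he⟩
  · simp [cellEnds]
  · induction e with
    | h u v => exact ⟨u, by simp [cellEnds]⟩

variable (D : PlaneDrawing H)

theorem exists_arc_eq_point {e : H.edgeSet} {v : W} (hv : v ∈ (e : Sym2 W)) :
    ∃ t, D.arc e t = D.point v := by
  have h : D.point v ∈ s(D.arc e 0, D.arc e 1) := by
    rw [D.arc_ends]
    exact Sym2.mem_map.2 ⟨v, hv, rfl⟩
  rcases Sym2.mem_iff.1 h with h | h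
  exacts [⟨0, h.symm⟩, ⟨1, h.symm⟩]

theorem exists_point_of_notMem_Ioo (e : H.edgeSet) {t : I} (ht : t ∉ Set.Ioo (0 : I) 1) :
    ∃ v ∈ (e : Sym2 W), D.arc e t = D.point v := by
  have hmem : D.arc e t ∈ s(D.arc e 0, D.arc e 1) := by
    rcases eq_or_ne t 0 with rfl | h0
    · simp
    rcases eq_or_ne t 1 with rfl | h1
    · simp
    exact absurd ⟨unitInterval.pos_iff_ne_zero.2 h0, unitInterval.lt_one_iff_ne_one.2 h1⟩ ht
  rw [D.arc_ends, Sym2.mem_map] at hmem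
  obtain ⟨u, hu, huv⟩ := hmem
  exact ⟨u, hu, huv.symm⟩

theorem mem_of_arc_eq_point {e : H.edgeSet} {v : W} {t : I} (h : D.arc e t = D.point v) :
    v ∈ (e : Sym2 W) := by
  by_cases ht : t ∈ Set.Ioo (0 : I) 1
  · exact absurd h (D.arc_ne_point e t ht v)
  · obtain ⟨u, hu, huv⟩ := D.exists_point_of_notMem_Ioo e ht
    rwa [← D.point_injective (huv.symm.trans h)]

theorem point_mem_cell {q : W ⊕ H.edgeSet} {v : W} (hv : v ∈ cellEnds q) :
    D.point v ∈ D.cell q := by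
  classical
  rcases q with u | e
  · simp only [cellEnds, Finset.mem_singleton] at hv
    simp [cell, hv]
  · exact D.exists_arc_eq_point (by simpa [cellEnds] using hv)

/-- Two pieces of a drawing that meet have a common end. -/
theorem exists_mem_cellEnds_of_mem_cell {p q : W ⊕ H.edgeSet} {z : ℂ} (hp : z ∈ D.cell p)
    (hq : z ∈ D.cell q) : ∃ v ∈ cellEnds p, v ∈ cellEnds q := by
  classical
  rcases p with u | e <;> rcases q with v | f
  · obtain rfl : z = D.point u := hp
    obtain rfl : u = v := D.point_injective hq
    simp [cellEnds]
  · obtain rfl : z = D.point u := hp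
    obtain ⟨t, ht⟩ := hq
    exact ⟨u, by simp [cellEnds], by simpa [cellEnds] using D.mem_of_arc_eq_point ht⟩
  · obtain rfl : z = D.point v := hq
    obtain ⟨t, ht⟩ := hp
    exact ⟨v, by simpa [cellEnds] using D.mem_of_arc_eq_point ht, by simp [cellEnds]⟩
  · obtain ⟨s, hs⟩ := hp
    obtain ⟨t, ht⟩ := hq
    by_cases hef : e = f
    · subst hef
      obtain ⟨v, hv⟩ := cellEnds_nonempty (Sum.inr e : W ⊕ H.edgeSet)
      exact ⟨v, hv, hv⟩
    by_cases hs' : s ∈ Set.Ioo (0 : I) 1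
    · by_cases ht' : t ∈ Set.Ioo (0 : I) 1
      · exact absurd (hs.trans ht.symm) (D.arc_disjoint e f hef s hs' t ht')
      · obtain ⟨v, hv, hv'⟩ := D.exists_point_of_notMem_Ioo f ht'
        exact ⟨v, by simpa [cellEnds] using D.mem_of_arc_eq_point (hs.trans (ht.symm.trans hv')),
          by simpa [cellEnds] using hv⟩
    · obtain ⟨v, hv, hv'⟩ := D.exists_point_of_notMem_Ioo e hs'
      exact ⟨v, by simpa [cellEnds] using hv,
        by simpa [cellEnds] using D.mem_of_arc_eq_point (ht.trans (hs.symm.trans hv'))⟩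

theorem isCompact_cell (q : W ⊕ H.edgeSet) : IsCompact (D.cell q) := by
  rcases q with v | e
  · exact isCompact_singleton
  · exact isCompact_range (D.arc e).continuous

theorem isPathConnected_cell (q : W ⊕ H.edgeSet) : IsPathConnected (D.cell q) := by
  rcases q with v | e
  · exact isPathConnected_singleton _
  · have : PathConnectedSpace I :=
      isPathConnected_iff_pathConnectedSpace.1 ((convex_Icc (0 : ℝ) 1).isPathConnected ⟨0, by simp⟩)
    exact isPathConnected_range (D.arc e).continuous

/-- The set `S` of vertices covers the set `A` of points if every piece of the drawing that meets
`A` has an end in `S`. -/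
def Covers (S : Finset W) (A : Set ℂ) : Prop :=
  ∀ q z, z ∈ D.cell q → z ∈ A → ∃ v ∈ cellEnds q, v ∈ S

variable {D}

theorem Covers.mono {S S' : Finset W} {A : Set ℂ} (h : D.Covers S A) (hS : S ⊆ S') :
    D.Covers S' A := fun q z hz hA =>
  let ⟨v, hv, hvS⟩ := h q z hz hA
  ⟨v, hv, hS hvS⟩

theorem covers_cell (q : W ⊕ H.edgeSet) : D.Covers (cellEnds q) (D.cell q) :=
  fun _ _ hz hA => D.exists_mem_cellEnds_of_mem_cell hz hA

theorem Covers.point_notMem {S : Finset W} {A : Set ℂ} (h : D.Covers S A) {v : W} (hv : v ∉ S) :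
    D.point v ∉ A := by
  intro hA
  obtain ⟨u, hu, huS⟩ := h (Sum.inl v) _ rfl hA
  simp only [cellEnds, Finset.mem_singleton] at hu
  exact hv (hu ▸ huS)

theorem Covers.arc_notMem {S : Finset W} {A : Set ℂ} (h : D.Covers S A) {e : H.edgeSet}
    (he : ∀ v ∈ (e : Sym2 W), v ∉ S) (t : I) : D.arc e t ∉ A := by
  classical
  intro hA
  obtain ⟨u, hu, huS⟩ := h (Sum.inr e) _ ⟨t, rfl⟩ hA
  exact he u (by simpa [cellEnds] using hu) huS

/-- In a finite drawing, all sufficiently small discs can be covered by two vertices: pieces without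
a common end are at a positive distance, so the ends of one piece that meets the disc cover it. -/
theorem exists_covers_closedBall [Finite W] (D : PlaneDrawing H) :
    ∃ δ > 0, ∀ a : ℂ, ∃ S : Finset W, S.card ≤ 2 ∧ D.Covers S (Metric.closedBall a δ) := by
  have hpair : ∀ pq : (W ⊕ H.edgeSet) × (W ⊕ H.edgeSet), ∃ ε > 0,
      Disjoint (cellEnds pq.1) (cellEnds pq.2) →
      ∀ x ∈ D.cell pq.1, ∀ y ∈ D.cell pq.2, ε < dist x y := by
    rintro ⟨p, q⟩
    by_cases h : Disjoint (cellEnds p) (cellEnds q)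
    · have hd : Disjoint (D.cell p) (D.cell q) := Set.disjoint_left.2 fun z hp hq =>
        let ⟨v, hv, hv'⟩ := D.exists_mem_cellEnds_of_mem_cell hp hq
        Finset.disjoint_left.1 h hv hv'
      obtain ⟨r, hr, hr'⟩ := Metric.exists_pos_forall_lt_edist (D.isCompact_cell p)
        (D.isCompact_cell q).isClosed hd
      refine ⟨r, hr, fun _ x hx y hy => ?_⟩
      have h1 := hr' x hx y hy
      rw [edist_nndist] at h1
      exact_mod_cast h1
    · exact ⟨1, one_pos, fun h' => absurd h' h⟩
  choose ε hε hεd using hpair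
  obtain ⟨δ, hδ, hδε⟩ : ∃ δ > 0, ∀ pq, 2 * δ ≤ ε pq := by
    have : Finite H.edgeSet := inferInstance
    cases nonempty_fintype ((W ⊕ H.edgeSet) × (W ⊕ H.edgeSet))
    rcases isEmpty_or_nonempty ((W ⊕ H.edgeSet) × (W ⊕ H.edgeSet)) with hE | hE
    · exact ⟨1, one_pos, fun pq => hE.elim pq⟩
    · obtain ⟨pq₀, h₀⟩ := Finite.exists_min ε
      exact ⟨ε pq₀ / 2, half_pos (hε _), fun pq => by linarith [h₀ pq]⟩
  refine ⟨δ, hδ, fun a => ?_⟩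
  by_cases hq : ∃ q z, z ∈ D.cell q ∧ z ∈ Metric.closedBall a δ
  · obtain ⟨q, z, hz, hza⟩ := hq
    refine ⟨cellEnds q, card_cellEnds_le q, fun p y hy hya => ?_⟩
    by_contra! hcon
    have h1 := hεd (p, q) (Finset.disjoint_left.2 hcon) y hy z hz
    have h2 := hδε (p, q)
    rw [Metric.mem_closedBall] at hza hya
    linarith [dist_triangle_right y z a]
  · exact ⟨∅, by simp, fun q z hz hza => absurd ⟨q, z, hz, hza⟩ hq⟩

end PlaneDrawing

/-! ### Branches of the logarithm over a drawing -/

namespace PlaneDrawing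

variable {W : Type*} {H : SimpleGraph W}

/-- `θ` assigns to every vertex `v` outside `S` a logarithm of `(z - v) / (o - v)`, in such a way
that these values extend to a continuous logarithm along the arc of every edge with both ends
outside `S`. Since `exp` has no zeros and division by zero gives zero, `exp_eq` also says that
neither `z` nor `o` is the point of a vertex outside `S`, and likewise for the arcs. -/
structure IsLogBranch (D : PlaneDrawing H) (o z : ℂ) (S : Finset W) (θ : W → ℂ) : Prop where
  exp_eq : ∀ v ∉ S, exp (θ v) = (z - D.point v) / (o - D.point v)
  exists_lift : ∀ e : H.edgeSet, (∀ v ∈ (e : Sym2 W), v ∉ S) →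
    ∃ Θ : I → ℂ, Continuous Θ ∧ (∀ t, exp (Θ t) = (z - D.arc e t) / (o - D.arc e t)) ∧
      ∀ t v, D.arc e t = D.point v → Θ t = θ v

variable {D : PlaneDrawing H} {o z z' : ℂ} {S S' : Finset W} {θ θ' : W → ℂ}

theorem div_mul_div_cancel_of_exp {a b c x : ℂ} (h : exp x = a / b) : a / b * (c / a) = c / b := by
  have ha : a ≠ 0 := by
    rintro rfl
    simp at h
  rw [div_mul_div_comm, mul_comm b a, mul_div_mul_left _ _ ha]

/-- A branch at `z` and a continuous logarithm of `(z' - a) / (z - a)` add up to a branch at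
`z'`. -/
theorem IsLogBranch.add (h : D.IsLogBranch o z S θ) (hS : S ⊆ S') (g : ℂ → ℂ)
    (hg : ∀ v ∉ S', exp (g (D.point v)) = (z' - D.point v) / (z - D.point v))
    (hg' : ∀ e : H.edgeSet, (∀ v ∈ (e : Sym2 W), v ∉ S') → (Continuous fun t => g (D.arc e t)) ∧
      ∀ t, exp (g (D.arc e t)) = (z' - D.arc e t) / (z - D.arc e t)) :
    D.IsLogBranch o z' S' fun v => θ v + g (D.point v) where
  exp_eq v hv := by
    have h1 := h.exp_eq v fun h => hv (hS h)
    rw [Complex.exp_add, hg v hv, h1, div_mul_div_cancel_of_exp h1]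
  exists_lift e he := by
    obtain ⟨Θ, hΘ, hΘe, hΘv⟩ := h.exists_lift e fun v hv h => he v hv (hS h)
    obtain ⟨hc, hexp⟩ := hg' e he
    refine ⟨fun t => Θ t + g (D.arc e t), hΘ.add hc, fun t => ?_, fun t v htv => ?_⟩
    · rw [Complex.exp_add, hexp, hΘe, div_mul_div_cancel_of_exp (hΘe t)]
    · simp only [hΘv t v htv, htv]

/-- A branch can be continued along every path that is covered by the exceptional set. -/
theorem IsLogBranch.exists_of_joinedIn (h : D.IsLogBranch o z S θ) (hS : S ⊆ S') {A : Set ℂ}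
    (hA : D.Covers S' A) (hz : JoinedIn A z z') : ∃ θ', D.IsLogBranch o z' S' θ' := by
  obtain ⟨γ, hγ⟩ := hz
  refine ⟨_, h.add hS (logChange γ) (fun v hv => ?_) fun e he => ⟨?_, fun t => ?_⟩⟩
  · simpa using exp_logChange (γ := (γ : C(I, ℂ))) (a := D.point v) fun s hs =>
      hA.point_notMem hv (hs ▸ hγ s)
  · exact continuous_logChange_comp γ (D.arc e) fun s t hs => hA.arc_notMem he t (hs ▸ hγ s)
  · simpa using exp_logChange (γ := (γ : C(I, ℂ))) (a := D.arc e t) fun s hs =>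
      hA.arc_notMem he t (hs ▸ hγ s)

theorem isLogBranch_self (hS : D.Covers S {o}) : D.IsLogBranch o o S 0 where
  exp_eq v hv := by
    rw [div_self (sub_ne_zero.2 fun h => hS.point_notMem hv h.symm)]
    simp
  exists_lift e he := by
    refine ⟨0, continuous_zero, fun t => ?_, by simp⟩
    rw [div_self (sub_ne_zero.2 fun h => hS.arc_notMem he t h.symm)]
    simp

open Classical in
theorem exists_isLogBranch_of_walk (D : PlaneDrawing H) {u x : W} (p : H.Walk u x) :
    ∃ θ, D.IsLogBranch (D.point x) (D.point u) p.support.toFinset θ := by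
  induction p with
  | nil =>
    exact ⟨0, isLogBranch_self ((covers_cell (Sum.inl _)).mono (by simp [cellEnds]))⟩
  | @cons u w x huw p ih =>
    obtain ⟨θ, hθ⟩ := ih
    set q : W ⊕ H.edgeSet := Sum.inr ⟨s(u, w), huw⟩
    have hq : cellEnds q = {u, w} := by
      ext; simp [q, cellEnds]
    refine hθ.exists_of_joinedIn (A := D.cell q) ?_ ?_ ?_
    · intro v hv
      simp only [SimpleGraph.Walk.support_cons, List.toFinset_cons, Finset.mem_insert]
      exact Or.inr hv
    · refine (covers_cell q).mono ?_
      rw [hq]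
      simp [Finset.insert_subset_iff]
    · exact (D.isPathConnected_cell q).joinedIn _ (D.point_mem_cell (by simp [hq])) _
        (D.point_mem_cell (by simp [hq]))

/-- Every point `z` of the plane carries a branch with a small exceptional set: the point nearest to
`z` on the drawing is joined to `z` by a segment that meets the drawing nowhere else, and to the
root along a short walk. -/
theorem exists_isLogBranch [Finite W] (D : PlaneDrawing H) (x₀ : W) (n : ℕ)
    (hwalk : ∀ u, ∃ p : H.Walk u x₀, p.length ≤ n) (z : ℂ) :
    ∃ (S : Finset W) (θ : W → ℂ), S.card ≤ n + 3 ∧ D.IsLogBranch (D.point x₀) z S θ := by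
  classical
  have hK : IsCompact (⋃ q, D.cell q) := isCompact_iUnion D.isCompact_cell
  obtain ⟨y, hy, hyd⟩ := hK.exists_infDist_eq_dist
    ⟨D.point x₀, Set.mem_iUnion.2 ⟨Sum.inl x₀, rfl⟩⟩ z
  obtain ⟨q, hq⟩ := Set.mem_iUnion.1 hy
  obtain ⟨u, hu⟩ := cellEnds_nonempty q
  obtain ⟨p, hp⟩ := hwalk u
  obtain ⟨θ, hθ⟩ := D.exists_isLogBranch_of_walk p
  obtain ⟨θ₁, hθ₁⟩ := hθ.exists_of_joinedIn Finset.subset_union_left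
    ((covers_cell q).mono Finset.subset_union_right)
    ((D.isPathConnected_cell q).joinedIn _ (D.point_mem_cell hu) _ hq)
  have hseg : D.Covers (p.support.toFinset ∪ cellEnds q) (segment ℝ y z) := by
    intro r x hx hxs
    obtain rfl : x = y := by
      have h1 : dist z y ≤ dist z x :=
        hyd ▸ Metric.infDist_le_dist_of_mem (Set.mem_iUnion.2 ⟨r, hx⟩)
      have h2 : dist y x + dist x z = dist y z := dist_add_dist_of_mem_segment hxs
      rw [dist_comm z y, dist_comm z x] at h1
      exact (dist_le_zero.1 (by linarith)).symm
    exact ((covers_cell q).mono Finset.subset_union_right) r x hx hq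
  obtain ⟨θ₂, hθ₂⟩ := hθ₁.exists_of_joinedIn subset_rfl hseg
    (((convex_segment y z).isPathConnected ⟨y, left_mem_segment ℝ y z⟩).joinedIn _
      (left_mem_segment ℝ y z) _ (right_mem_segment ℝ y z))
  refine ⟨_, θ₂, ?_, hθ₂⟩
  have h1 := p.support.toFinset_card_le
  rw [SimpleGraph.Walk.length_support] at h1
  have h2 := card_cellEnds_le q
  have h3 := Finset.card_union_le p.support.toFinset (cellEnds q)
  omega

/-! ### The transition between two branches -/

/-- The difference between two branches of the logarithm, taken at the nearby points `a` and `b`. At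
a vertex it is `2πi` times the winding number of the loop that runs from the root to `a`, on to `b`,
and back to the root. -/
noncomputable def transition (D : PlaneDrawing H) (a b : ℂ) (θ θ' : W → ℂ) (v : W) : ℂ :=
  θ v + log ((b - D.point v) / (a - D.point v)) - θ' v

theorem re_div_pos_of_dist_lt {a b v : ℂ} (h : dist b a < dist v a) :
    0 < ((b - v) / (a - v)).re := by
  have hne : a - v ≠ 0 := by
    intro h0
    rw [sub_eq_zero.1 h0, dist_self] at h
    exact absurd h (not_lt.2 dist_nonneg)
  have h1 : (b - v) / (a - v) = 1 + (b - a) / (a - v) := by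
    field_simp
    ring
  have h2 : ‖(b - a) / (a - v)‖ < 1 := by
    rw [norm_div, div_lt_one (norm_pos_iff.2 hne)]
    rwa [dist_eq_norm, dist_comm, dist_eq_norm] at h
  rw [h1, Complex.add_re, Complex.one_re]
  linarith [neg_abs_le ((b - a) / (a - v)).re, Complex.abs_re_le_norm ((b - a) / (a - v))]

/-- The transition is locally constant on the graph without the exceptional vertices, because its
continuous extension along an edge takes values in `2πiℤ`. -/
theorem transition_eq_of_adj {a b : ℂ} {δ : ℝ} (hab : dist b a ≤ δ)
    (hθ : D.IsLogBranch o a S θ) (hθ' : D.IsLogBranch o b S θ')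
    (hS : D.Covers S (Metric.closedBall a δ)) {u v : W} (huv : H.Adj u v) (hu : u ∉ S)
    (hv : v ∉ S) : D.transition a b θ θ' u = D.transition a b θ θ' v := by
  set e : H.edgeSet := ⟨s(u, v), huv⟩
  have he : ∀ w ∈ (e : Sym2 W), w ∉ S := by
    intro w hw
    rcases Sym2.mem_iff.1 hw with rfl | rfl <;> assumption
  obtain ⟨Θ, hΘ, hΘe, hΘv⟩ := hθ.exists_lift e he
  obtain ⟨Θ', hΘ', hΘe', hΘv'⟩ := hθ'.exists_lift e he
  have hpos : ∀ t, 0 < ((b - D.arc e t) / (a - D.arc e t)).re := fun t =>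
    re_div_pos_of_dist_lt (hab.trans_lt (not_le.1 fun h => hS.arc_notMem he t h))
  have hne : ∀ t, a - D.arc e t ≠ 0 := fun t h => by
    have := hpos t
    simp [h] at this
  have hne' : ∀ t, b - D.arc e t ≠ 0 := fun t h => by
    have := hpos t
    simp [h] at this
  have hcont : Continuous fun t => Θ t + log ((b - D.arc e t) / (a - D.arc e t)) - Θ' t := by
    refine (hΘ.add (Continuous.clog ?_ fun t => Or.inl (hpos t))).sub hΘ'
    exact (by fun_prop : Continuous fun t => b - D.arc e t).div (by fun_prop) hne
  have hone : ∀ t, exp (Θ t + log ((b - D.arc e t) / (a - D.arc e t)) - Θ' t) = 1 := fun t => by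
    rw [Complex.exp_sub, Complex.exp_add, Complex.exp_log (div_ne_zero (hne' t) (hne t)), hΘe,
      hΘe', div_mul_div_cancel_of_exp (hΘe t), ← hΘe', div_self (Complex.exp_ne_zero _)]
  obtain ⟨s, hs⟩ := D.exists_arc_eq_point (e := e) (v := u) (by simp [e])
  obtain ⟨t, ht⟩ := D.exists_arc_eq_point (e := e) (v := v) (by simp [e])
  have := eq_of_continuous_of_exp_eq_one hcont hone s t
  simp only [hs, ht, hΘv s u hs, hΘv t v ht, hΘv' s u hs, hΘv' t v ht] at this
  exact this

/-- The transitions around a small quadrilateral `a b d c` add up to zero. -/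
theorem transition_add_transition {a b c d : ℂ} {θa θb θc θd : W → ℂ} {v : W}
    (hab : dist b a < dist (D.point v) a) (hbd : dist d b < dist (D.point v) b)
    (hac : dist c a < dist (D.point v) a) (hcd : dist d c < dist (D.point v) c) :
    D.transition a b θa θb v + D.transition b d θb θd v =
      D.transition a c θa θc v + D.transition c d θc θd v := by
  have key : ∀ {x y : ℂ}, dist y x < dist (D.point v) x →
      exp (log ((y - D.point v) / (x - D.point v))) = (y - D.point v) / (x - D.point v) ∧
      |(log ((y - D.point v) / (x - D.point v))).im| < Real.pi / 2 ∧ x - D.point v ≠ 0 ∧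
      y - D.point v ≠ 0 := by
    intro x y h
    have h1 := re_div_pos_of_dist_lt h
    have h0 : (y - D.point v) / (x - D.point v) ≠ 0 := fun h => by simp [h] at h1
    exact ⟨Complex.exp_log h0, abs_log_im_lt_pi_div_two h1, (div_ne_zero_iff.1 h0).2,
      (div_ne_zero_iff.1 h0).1⟩
  obtain ⟨e1, i1, n1, n1'⟩ := key hab
  obtain ⟨e2, i2, n2, n2'⟩ := key hbd
  obtain ⟨e3, i3, n3, n3'⟩ := key hac
  obtain ⟨e4, i4, n4, n4'⟩ := key hcd
  simp only [transition]
  set l1 := log ((b - D.point v) / (a - D.point v))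
  set l2 := log ((d - D.point v) / (b - D.point v))
  set l3 := log ((c - D.point v) / (a - D.point v))
  set l4 := log ((d - D.point v) / (c - D.point v))
  have h0 : l1 + l2 - l3 - l4 = 0 := by
    refine eq_zero_of_exp_eq_one_of_abs_im_lt ?_ ?_
    · rw [Complex.exp_sub, Complex.exp_sub, Complex.exp_add, e1, e2, e3, e4]
      field_simp
    · simp only [Complex.sub_im, Complex.add_im]
      rw [abs_lt] at *
      constructor <;> linarith [i1.1, i1.2, i2.1, i2.2, i3.1, i3.2, i4.1, i4.2]
  linear_combination h0

end PlaneDrawing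

/-! ### A polar grid -/

/-- The points of a polar grid with `M + 1` concentric rings, the largest of radius `R`, and `M`
directions. The angular index `k` is not reduced modulo `M`. -/
noncomputable def polarGrid (R : ℝ) (M i k : ℕ) : ℂ :=
  (R * (i / M) : ℝ) * exp (Complex.I * (2 * Real.pi * k / M : ℝ))

theorem norm_exp_I_mul_sub_le (x y : ℝ) :
    ‖exp (Complex.I * x) - exp (Complex.I * y)‖ ≤ |x - y| := by
  have h : exp (Complex.I * x) - exp (Complex.I * y) =
      exp (Complex.I * y) * (exp (Complex.I * (x - y : ℝ)) - 1) := by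
    rw [mul_sub, ← Complex.exp_add, mul_one]
    congr 2
    push_cast
    ring
  rw [h, norm_mul, mul_comm Complex.I (y : ℂ), Complex.norm_exp_ofReal_mul_I, one_mul]
  exact Real.norm_exp_I_mul_ofReal_sub_one_le

theorem polarGrid_zero_left (R : ℝ) (M k : ℕ) : polarGrid R M 0 k = 0 := by
  simp [polarGrid]

theorem polarGrid_period (R : ℝ) {M : ℕ} (hM : M ≠ 0) (i : ℕ) :
    polarGrid R M i M = polarGrid R M i 0 := by
  have h : exp (Complex.I * (2 * Real.pi * M / M : ℝ)) = 1 := by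
    rw [mul_div_assoc, div_self (Nat.cast_ne_zero.2 hM), mul_one]
    push_cast
    rw [mul_comm, Complex.exp_two_pi_mul_I]
  rw [polarGrid, polarGrid, h]
  simp

theorem norm_polarGrid_last {R : ℝ} (hR : 0 < R) {M : ℕ} (hM : M ≠ 0) (k : ℕ) :
    ‖polarGrid R M M k‖ = R := by
  rw [polarGrid, norm_mul, mul_comm Complex.I, Complex.norm_exp_ofReal_mul_I,
    div_self (Nat.cast_ne_zero.2 hM)]
  simp [abs_of_pos hR]

theorem polarGrid_eq_mul_exp (R : ℝ) (M i k : ℕ) :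
    polarGrid R M i k = polarGrid R M i 0 * exp (Complex.I * (2 * Real.pi * k / M : ℝ)) := by
  simp [polarGrid]

theorem polarGrid_succ_right (R : ℝ) (M i k : ℕ) :
    polarGrid R M i (k + 1) =
      polarGrid R M i k * exp (Complex.I * (2 * Real.pi / M : ℝ)) := by
  rw [polarGrid, polarGrid, mul_assoc _ (exp _) (exp _), ← Complex.exp_add]
  congr 2
  push_cast
  ring

theorem dist_polarGrid_succ_right {R : ℝ} (hR : 0 < R) {M i : ℕ} (hM : M ≠ 0) (hi : i ≤ M)
    (k : ℕ) : dist (polarGrid R M i (k + 1)) (polarGrid R M i k) ≤ R * (2 * Real.pi / M) := by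
  have hM' : (0 : ℝ) < M := by positivity
  have hle : (i / M : ℝ) ≤ 1 := (div_le_one hM').2 (by exact_mod_cast hi)
  rw [dist_eq_norm, polarGrid, polarGrid, ← mul_sub, norm_mul, Complex.norm_real]
  refine mul_le_mul ?_ ((norm_exp_I_mul_sub_le _ _).trans_eq ?_) (norm_nonneg _) hR.le
  · rw [Real.norm_of_nonneg (by positivity)]
    exact mul_le_of_le_one_right hR.le hle
  · rw [abs_of_nonneg]
    · push_cast; ring
    · rw [← sub_div, ← mul_sub]
      push_cast
      rw [add_sub_cancel_left]
      positivity

theorem dist_polarGrid_succ_left {R : ℝ} (hR : 0 < R) {M : ℕ} (i k : ℕ) :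
    dist (polarGrid R M (i + 1) k) (polarGrid R M i k) ≤ R * (2 * Real.pi / M) := by
  rw [dist_eq_norm, polarGrid, polarGrid, ← sub_mul, norm_mul, mul_comm Complex.I,
    Complex.norm_exp_ofReal_mul_I, mul_one, ← Complex.ofReal_sub, Complex.norm_real, ← mul_sub,
    ← sub_div]
  push_cast
  rw [add_sub_cancel_left, Real.norm_of_nonneg (by positivity)]
  gcongr
  linarith [Real.pi_gt_three]

/-- If the boundary values of a closed discrete 1-form on a rectangle vanish on two opposite sides,
then its sums over the other two sides agree. -/
theorem sum_eq_sum_of_cocycle {A : Type*} [AddCommGroup A] {M K : ℕ} {h v : ℕ → ℕ → A}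
    (hc : ∀ i < M, ∀ k < K, h i k + v i (k + 1) = v i k + h (i + 1) k)
    (h0 : ∀ k, h 0 k = 0) (hM : ∀ k, h M k = 0) :
    ∑ i ∈ Finset.range M, v i K = ∑ i ∈ Finset.range M, v i 0 := by
  induction K with
  | zero => rfl
  | succ K ih =>
    rw [← ih fun i hi k hk => hc i hi k (hk.trans (Nat.lt_succ_self K)), ← sub_eq_zero,
      ← Finset.sum_sub_distrib]
    have : ∀ i ∈ Finset.range M, v i (K + 1) - v i K = h (i + 1) K - h i K := fun i hi => by
      rw [sub_eq_sub_iff_add_eq_add, add_comm, hc i (Finset.mem_range.1 hi) K (Nat.lt_succ_self K),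
        add_comm]
    rw [Finset.sum_congr rfl this, Finset.sum_range_sub (fun i => h i K), h0, hM, sub_zero]

theorem re_one_sub_div_pos {z p : ℂ} (h : ‖p‖ < ‖z‖) : 0 < (1 - p / z).re := by
  have h1 : ‖p / z‖ < 1 := by
    rw [norm_div]
    exact (div_lt_one ((norm_nonneg p).trans_lt h)).2 h
  rw [Complex.sub_re, Complex.one_re]
  linarith [Complex.re_le_norm (p / z)]

/-- Along a short step from `z` to `z * exp (I * t)` on a circle around the disc that contains `p`,
the principal logarithm grows by `I * t` up to a single-valued term. -/
theorem log_div_eq_of_rotation {z p : ℂ} {t : ℝ} (h : ‖p‖ < ‖z‖) (ht : 0 ≤ t)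
    (ht' : t < Real.pi / 2)
    (hd : dist (z * exp (Complex.I * t)) z < dist p z) :
    log ((z * exp (Complex.I * t) - p) / (z - p)) =
      Complex.I * t + log (1 - p / (z * exp (Complex.I * t))) - log (1 - p / z) := by
  set z' := z * exp (Complex.I * t) with hz'
  have hn : ‖z'‖ = ‖z‖ := by
    rw [hz', norm_mul, mul_comm Complex.I, Complex.norm_exp_ofReal_mul_I, mul_one]
  have hz0 : z ≠ 0 := norm_pos_iff.1 ((norm_nonneg p).trans_lt h)
  have hz0' : z' ≠ 0 := norm_pos_iff.1 (hn ▸ (norm_nonneg p).trans_lt h)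
  have r1 := re_one_sub_div_pos h
  have r2 := re_one_sub_div_pos (hn.symm ▸ h : ‖p‖ < ‖z'‖)
  have r3 := PlaneDrawing.re_div_pos_of_dist_lt hd
  have n1 : 1 - p / z ≠ 0 := fun h => by simp [h] at r1
  have n2 : 1 - p / z' ≠ 0 := fun h => by simp [h] at r2
  have n3 : (z' - p) / (z - p) ≠ 0 := fun h => by simp [h] at r3
  have i1 := abs_lt.1 (abs_log_im_lt_pi_div_two r1)
  have i2 := abs_lt.1 (abs_log_im_lt_pi_div_two r2)
  have i3 := abs_lt.1 (abs_log_im_lt_pi_div_two r3)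
  have key : log ((z' - p) / (z - p)) -
      (Complex.I * t + log (1 - p / z') - log (1 - p / z)) = 0 := by
    refine eq_zero_of_exp_eq_one_of_abs_im_lt ?_ ?_
    · rw [Complex.exp_sub, Complex.exp_sub, Complex.exp_add, Complex.exp_log n1,
        Complex.exp_log n2, Complex.exp_log n3]
      have e : exp (Complex.I * t) = z' / z := by rw [hz']; field_simp
      have n4 : z - p ≠ 0 := (div_ne_zero_iff.1 n3).2
      have n5 : z' - p ≠ 0 := (div_ne_zero_iff.1 n3).1
      have e1 : 1 - p / z = (z - p) / z := by field_simp
      have e2 : 1 - p / z' = (z' - p) / z' := by field_simp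
      rw [e, e1, e2]
      field_simp
    · simp only [Complex.sub_im, Complex.add_im, Complex.mul_im, Complex.I_re, Complex.I_im,
        Complex.ofReal_re, Complex.ofReal_im]
      rw [abs_lt]
      constructor <;> linarith
  exact sub_eq_zero.1 key

/-! ### The separator theorem -/

/-- Four sets that each fill more than three quarters of a finite type have a common element. -/
theorem exists_mem_four_of_card_lt {W : Type*} [Fintype W] {A B C D : Finset W}
    (hA : 3 * Fintype.card W < 4 * A.card) (hB : 3 * Fintype.card W < 4 * B.card)
    (hC : 3 * Fintype.card W < 4 * C.card) (hD : 3 * Fintype.card W < 4 * D.card) :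
    ∃ v, v ∈ A ∧ v ∈ B ∧ v ∈ C ∧ v ∈ D := by
  classical
  by_contra! h
  have hU : (Finset.univ : Finset W) ⊆ (Aᶜ ∪ Bᶜ) ∪ (Cᶜ ∪ Dᶜ) := by
    intro v _
    simp only [Finset.mem_union, Finset.mem_compl]
    by_contra! hv
    exact h v hv.1.1 hv.1.2 hv.2.1 hv.2.2
  have h0 := Finset.card_le_card hU
  have h1 := Finset.card_union_le (Aᶜ ∪ Bᶜ) (Cᶜ ∪ Dᶜ)
  have h2 := Finset.card_union_le Aᶜ Bᶜ
  have h3 := Finset.card_union_le Cᶜ Dᶜ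
  have a := Finset.card_compl_add_card A
  have b := Finset.card_compl_add_card B
  have c := Finset.card_compl_add_card C
  have d := Finset.card_compl_add_card D
  rw [Finset.card_univ] at h0
  omega

open Classical in
/-- **Separators of plane graphs of small radius.** If every vertex is within distance `n` of a
root, then some set `S` of at most `2 * n + 8` vertices splits the rest of the graph into classes
without edges between them, each with at most three quarters of all vertices. The classes are the
level sets of the locally constant function `c`. -/
theorem PlaneDrawing.exists_separator {W : Type*} [Fintype W] {H : SimpleGraph W}
    (D : PlaneDrawing H) (x₀ : W) (n : ℕ) (hwalk : ∀ u, ∃ p : H.Walk u x₀, p.length ≤ n) :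
    ∃ (S : Finset W) (c : W → ℂ), S.card ≤ 2 * n + 8 ∧
      (∀ u v, H.Adj u v → u ∉ S → v ∉ S → c u = c v) ∧
      ∀ m, 4 * (Finset.univ.filter fun v => v ∉ S ∧ c v = m).card ≤ 3 * Fintype.card W := by
  by_contra! hcon
  obtain ⟨δ, hδ, hcov⟩ := D.exists_covers_closedBall
  choose B hBcard hB using hcov
  choose S₀ θ₀ hS₀ hθ₀ using D.exists_isLogBranch x₀ n hwalk
  have hK : IsCompact (⋃ q, D.cell q) := isCompact_iUnion D.isCompact_cell
  obtain ⟨R, hR, hKR⟩ := hK.isBounded.subset_ball_lt 0 0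
  have hcell : ∀ q, ∀ y ∈ D.cell q, ‖y‖ < R := fun q y hy =>
    mem_ball_zero_iff.1 (hKR (Set.mem_iUnion.2 ⟨q, hy⟩))
  have hpt : ∀ v, ‖D.point v‖ < R := fun v => hcell (Sum.inl v) _ rfl
  -- The mesh of the grid is at most `δ`, and one angular step is less than a right angle.
  obtain ⟨L, hL⟩ := exists_nat_gt (max 4 (R * (2 * Real.pi) / δ))
  set M := L + 1 with hMdef
  have hM : M ≠ 0 := Nat.succ_ne_zero L
  have hM4 : (4 : ℝ) < M := by
    have := (le_max_left _ _).trans_lt hL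
    push_cast [hMdef]; linarith
  have hMpos : (0 : ℝ) < M := by linarith
  have hmesh : R * (2 * Real.pi / M) ≤ δ := by
    have h1 := (le_max_right 4 (R * (2 * Real.pi) / δ)).trans_lt hL
    rw [div_lt_iff₀ hδ] at h1
    rw [← mul_div_assoc, div_le_iff₀ hMpos]
    push_cast [hMdef]; nlinarith
  have hstep : 2 * Real.pi / M < Real.pi / 2 := by
    rw [div_lt_div_iff₀ hMpos two_pos]
    nlinarith [Real.pi_pos]
  set z : ℕ → ℕ → ℂ := polarGrid R M with hz
  -- On the last ring the branch is that of the first direction, continued along the circle.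
  set g : ℕ → ℂ → ℂ := fun k p => Complex.I * (2 * Real.pi * k / M : ℝ) +
    log (1 - p / z M k) - log (1 - p / z M 0) with hg
  set T : ℕ → ℕ → Finset W := fun i k => if i < M then S₀ (z i k) else S₀ (z M 0) with hT
  set φ : ℕ → ℕ → W → ℂ := fun i k =>
    if i < M then θ₀ (z i k) else fun v => θ₀ (z M 0) v + g k (D.point v) with hφ
  have hTcard : ∀ i k, (T i k).card ≤ n + 3 := by
    intro i k
    simp only [hT]
    split_ifs <;> exact hS₀ _
  have hnorm : ∀ k, ‖z M k‖ = R := norm_polarGrid_last hR hM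
  have hgexp : ∀ k p, ‖p‖ < R → exp (g k p) = (z M k - p) / (z M 0 - p) := by
    intro k p hp
    have n1 : 1 - p / z M k ≠ 0 := fun h => by
      have := re_one_sub_div_pos (hp.trans_eq (hnorm k).symm)
      simp [h] at this
    have n2 : 1 - p / z M 0 ≠ 0 := fun h => by
      have := re_one_sub_div_pos (hp.trans_eq (hnorm 0).symm)
      simp [h] at this
    have z1 : z M k ≠ 0 := norm_pos_iff.1 (hnorm k ▸ hR)
    have z2 : z M 0 ≠ 0 := norm_pos_iff.1 (hnorm 0 ▸ hR)
    have e : exp (Complex.I * (2 * Real.pi * k / M : ℝ)) = z M k / z M 0 := by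
      rw [eq_div_iff z2, mul_comm]
      exact (polarGrid_eq_mul_exp R M M k).symm
    have e1 : 1 - p / z M k = (z M k - p) / z M k := by field_simp
    have e2 : 1 - p / z M 0 = (z M 0 - p) / z M 0 := by field_simp
    have n3 : z M 0 - p ≠ 0 := fun h => n2 (by rw [e2, h, zero_div])
    simp only [hg]
    rw [Complex.exp_sub, Complex.exp_add, Complex.exp_log n1, Complex.exp_log n2, e, e1, e2]
    field_simp
  have hgcont : ∀ k (e : C(I, ℂ)), (∀ t, ‖e t‖ < R) → Continuous fun t => g k (e t) := by
    intro k e he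
    have h1 : ∀ j, Continuous fun t => log (1 - e t / z M j) := fun j =>
      Continuous.clog (by fun_prop)
        fun t => Or.inl (re_one_sub_div_pos ((he t).trans_eq (hnorm j).symm))
    exact (continuous_const.add (h1 k)).sub (h1 0)
  have hbranch : ∀ i k, i ≤ M → D.IsLogBranch (D.point x₀) (z i k) (T i k) (φ i k) := by
    intro i k hi
    by_cases hiM : i < M
    · simp only [hT, hφ, if_pos hiM]
      exact hθ₀ _
    · obtain rfl : i = M := le_antisymm hi (not_lt.1 hiM)
      simp only [hT, hφ, if_neg hiM]
      exact (hθ₀ _).add subset_rfl (g k) (fun v _ => hgexp k _ (hpt v)) fun e _ =>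
        ⟨hgcont k (D.arc e) fun t => hcell (Sum.inr e) _ ⟨t, rfl⟩,
          fun t => hgexp k _ (hcell (Sum.inr e) _ ⟨t, rfl⟩)⟩
  -- Every edge of the grid has a transition value that is taken by a large majority of vertices.
  set E : ℕ → ℕ → ℕ → ℕ → Finset W := fun i k i' k' => T i k ∪ T i' k' ∪ B (z i k) with hE
  set τ : ℕ → ℕ → ℕ → ℕ → W → ℂ := fun i k i' k' =>
    D.transition (z i k) (z i' k') (φ i k) (φ i' k') with hτ
  have hmaj : ∀ i k i' k', i ≤ M → i' ≤ M → dist (z i' k') (z i k) ≤ δ → ∃ m,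
      3 * Fintype.card W < 4 * (Finset.univ.filter fun v => v ∉ E i k i' k' ∧
        τ i k i' k' v = m).card := by
    intro i k i' k' hi hi' hd
    refine hcon _ _ ?_ fun u v huv hu hv => ?_
    · have h1 := Finset.card_union_le (T i k ∪ T i' k') (B (z i k))
      have h2 := Finset.card_union_le (T i k) (T i' k')
      have h3 := hTcard i k
      have h4 := hTcard i' k'
      have h5 := hBcard (z i k)
      simp only [hE]
      omega
    · simp only [hE, Finset.notMem_union] at hu hv
      -- The exceptional sets of the two branches may be enlarged to their union.
      have mono : ∀ {w : ℂ} {S S' : Finset W} {θ : W → ℂ}, S ⊆ S' →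
          D.IsLogBranch (D.point x₀) w S θ → D.IsLogBranch (D.point x₀) w S' θ :=
        fun hS h => ⟨fun v hv => h.exp_eq v fun h => hv (hS h),
          fun e he => h.exists_lift e fun v hv h => he v hv (hS h)⟩
      refine D.transition_eq_of_adj (S := E i k i' k') hd
        (mono ?_ (hbranch i k hi)) (mono ?_ (hbranch i' k' hi'))
        ((hB (z i k)).mono Finset.subset_union_right) huv ?_ ?_
      · exact Finset.subset_union_left.trans Finset.subset_union_left
      · exact Finset.subset_union_right.trans Finset.subset_union_left
      · simpa only [hE, Finset.notMem_union] using hu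
      · simpa only [hE, Finset.notMem_union] using hv
  choose! m hm using hmaj
  -- A relation between majority values is read off at a vertex common to the majorities involved.
  have hdr : ∀ i k, i ≤ M → dist (z i (k + 1)) (z i k) ≤ δ := fun i k hi =>
    (dist_polarGrid_succ_right hR hM hi k).trans hmesh
  have hdl : ∀ i k, dist (z (i + 1) k) (z i k) ≤ δ := fun i k =>
    (dist_polarGrid_succ_left hR i k).trans hmesh
  have hfar : ∀ {i k i' k' v}, v ∉ E i k i' k' → δ < dist (D.point v) (z i k) := by
    intro i k i' k' v hv
    simp only [hE, Finset.notMem_union] at hv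
    exact not_le.1 fun h => (hB (z i k)).point_notMem hv.2 h
  have hcocycle : ∀ i < M, ∀ k < M,
      m i k i (k + 1) + m i (k + 1) (i + 1) (k + 1) =
        m i k (i + 1) k + m (i + 1) k (i + 1) (k + 1) := by
    intro i hi k _
    obtain ⟨v, h1, h2, h3, h4⟩ := exists_mem_four_of_card_lt
      (hm i k i (k + 1) hi.le hi.le (hdr i k hi.le))
      (hm i (k + 1) (i + 1) (k + 1) hi.le hi (hdl i (k + 1)))
      (hm i k (i + 1) k hi.le hi (hdl i k))
      (hm (i + 1) k (i + 1) (k + 1) hi hi (hdr (i + 1) k hi))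
    simp only [Finset.mem_filter, Finset.mem_univ, true_and] at h1 h2 h3 h4
    rw [← h1.2, ← h2.2, ← h3.2, ← h4.2]
    exact D.transition_add_transition ((hdr i k hi.le).trans_lt (hfar h1.1))
      ((hdl i (k + 1)).trans_lt (hfar h2.1)) ((hdl i k).trans_lt (hfar h3.1))
      ((hdr (i + 1) k hi).trans_lt (hfar h4.1))
  have hinner : ∀ k, m 0 k 0 (k + 1) = 0 := by
    intro k
    obtain ⟨v, h1, -⟩ := exists_mem_four_of_card_lt
      (hm 0 k 0 (k + 1) (Nat.zero_le _) (Nat.zero_le _) (hdr 0 k (Nat.zero_le _)))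
      (hm 0 k 0 (k + 1) (Nat.zero_le _) (Nat.zero_le _) (hdr 0 k (Nat.zero_le _)))
      (hm 0 k 0 (k + 1) (Nat.zero_le _) (Nat.zero_le _) (hdr 0 k (Nat.zero_le _)))
      (hm 0 k 0 (k + 1) (Nat.zero_le _) (Nat.zero_le _) (hdr 0 k (Nat.zero_le _)))
    simp only [Finset.mem_filter, Finset.mem_univ, true_and] at h1
    have hz0 : ∀ j, z 0 j = 0 := polarGrid_zero_left R M
    have hM0 : 0 < M := Nat.succ_pos L
    rw [← h1.2]
    simp only [hτ, PlaneDrawing.transition, hφ, if_pos hM0, hz0]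
    simp
  have houter : ∀ k, m M k M (k + 1) = 0 := by
    intro k
    obtain ⟨v, h1, -⟩ := exists_mem_four_of_card_lt
      (hm M k M (k + 1) le_rfl le_rfl (hdr M k le_rfl))
      (hm M k M (k + 1) le_rfl le_rfl (hdr M k le_rfl))
      (hm M k M (k + 1) le_rfl le_rfl (hdr M k le_rfl))
      (hm M k M (k + 1) le_rfl le_rfl (hdr M k le_rfl))
    simp only [Finset.mem_filter, Finset.mem_univ, true_and] at h1
    have hz1 : z M (k + 1) = z M k * exp (Complex.I * (2 * Real.pi / M : ℝ)) :=
      polarGrid_succ_right R M M k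
    have hlog := log_div_eq_of_rotation ((hpt v).trans_eq (hnorm k).symm)
      (by positivity) hstep (hz1 ▸ (hdr M k le_rfl).trans_lt (hfar h1.1))
    rw [← hz1] at hlog
    rw [← h1.2]
    simp only [hτ, PlaneDrawing.transition, hφ, if_neg (lt_irrefl M), hlog, hg]
    push_cast
    ring
  have hperiod : ∀ i, z i M = z i 0 := polarGrid_period R hM
  have hgM : ∀ p, g M p = g 0 p + 2 * Real.pi * Complex.I := by
    intro p
    have : (2 * Real.pi * M / M : ℝ) = 2 * Real.pi := by
      rw [mul_div_assoc, div_self hMpos.ne', mul_one]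
    simp only [hg, hperiod, this]
    push_cast
    simp
    ring
  have hside : ∀ i < L, m i M (i + 1) M = m i 0 (i + 1) 0 := by
    intro i hi
    have hi1 : i < M := hi.trans (Nat.lt_succ_self L)
    have hi2 : i + 1 < M := Nat.succ_lt_succ hi
    obtain ⟨v, h1, h2, -⟩ := exists_mem_four_of_card_lt
      (hm i M (i + 1) M hi1.le hi1 (hdl i M)) (hm i 0 (i + 1) 0 hi1.le hi1 (hdl i 0))
      (hm i 0 (i + 1) 0 hi1.le hi1 (hdl i 0)) (hm i 0 (i + 1) 0 hi1.le hi1 (hdl i 0))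
    simp only [Finset.mem_filter, Finset.mem_univ, true_and] at h1 h2
    rw [← h1.2, ← h2.2]
    simp only [hτ, hφ, if_pos hi1, if_pos hi2, hperiod]
  have hlast : m L M M M = m L 0 M 0 - 2 * Real.pi * Complex.I := by
    have hL1 : L < M := Nat.lt_succ_self L
    obtain ⟨v, h1, h2, -⟩ := exists_mem_four_of_card_lt
      (hm L M M M hL1.le le_rfl (hdl L M)) (hm L 0 M 0 hL1.le le_rfl (hdl L 0))
      (hm L 0 M 0 hL1.le le_rfl (hdl L 0)) (hm L 0 M 0 hL1.le le_rfl (hdl L 0))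
    simp only [Finset.mem_filter, Finset.mem_univ, true_and] at h1 h2
    rw [← h1.2, ← h2.2]
    simp only [hτ, PlaneDrawing.transition, hφ, if_pos hL1, if_neg (lt_irrefl M), hperiod, hgM]
    ring
  -- Summation over the grid: the two radial sides differ by one turn on the last ring only.
  have hsum := sum_eq_sum_of_cocycle (h := fun i k => m i k i (k + 1))
    (v := fun i k => m i k (i + 1) k) hcocycle hinner houter
  rw [hMdef, Finset.sum_range_succ, Finset.sum_range_succ, ← hMdef,
    Finset.sum_congr rfl fun i hi => hside i (Finset.mem_range.1 hi), hlast] at hsum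
  have : (2 * Real.pi * Complex.I : ℂ) = 0 := by linear_combination -hsum
  exact Complex.two_pi_I_ne_zero this

/-! ### Congestion from separators -/

theorem exists_mem_support_of_ne {W X : Type*} {H : SimpleGraph W} {S : Finset W} {c : W → X}
    (hc : ∀ u v, H.Adj u v → u ∉ S → v ∉ S → c u = c v) {s t : W} (p : H.Walk s t)
    (h : ¬(s ∉ S ∧ t ∉ S ∧ c s = c t)) : ∃ v ∈ S, v ∈ p.support := by
  by_contra! hp
  have key : ∀ {s t : W} (p : H.Walk s t), (∀ v ∈ S, v ∉ p.support) → c s = c t := by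
    intro s t p
    induction p with
    | nil => intro _; rfl
    | @cons u w x huw p ih =>
      intro hp
      simp only [SimpleGraph.Walk.support_cons, List.mem_cons, not_or] at hp
      rw [hc u w huw (fun hu => (hp u hu).1 rfl) fun hw => (hp w hw).2 p.start_mem_support]
      exact ih fun v hv => (hp v hv).2
  exact h ⟨fun hs => hp s hs p.start_mem_support, fun ht => hp t ht p.end_mem_support, key p hp⟩

open Classical in
/-- If every walk between the two nodes of each pair in `P` meets `S`, then the nodes of `S` carry
together at least the demand of these pairs. -/
theorem Routing.card_le_sum_load {W : Type*} [Fintype W] {H : SimpleGraph W} (R : Routing H)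
    (S : Finset W) (P : Finset (W × W)) (hP : P ⊆ Finset.univ.offDiag)
    (hS : ∀ q ∈ P, ∀ p : H.Walk q.1 q.2, ∃ v ∈ S, v ∈ p.support) :
    (P.card : ℝ) / 2 ≤ ∑ v ∈ S, R.load v := by
  have hle : ∀ q ∈ P, (1 : ℝ) ≤
      ∑ v ∈ S, (R.amount q.1 q.2).sum fun p a => if v ∈ p.support then a else 0 := by
    intro q hq
    have hne : q.1 ≠ q.2 := (Finset.mem_offDiag.1 (hP hq)).2.2
    rw [← R.total q.1 q.2 hne]
    simp only [Finsupp.sum]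
    rw [Finset.sum_comm]
    refine Finset.sum_le_sum fun p _ => ?_
    obtain ⟨v, hv, hvp⟩ := hS q hq p
    calc R.amount q.1 q.2 p = if v ∈ p.support then R.amount q.1 q.2 p else 0 := by rw [if_pos hvp]
      _ ≤ _ := Finset.single_le_sum
        (f := fun v => if v ∈ p.support then R.amount q.1 q.2 p else 0)
        (fun w _ => by split_ifs; exacts [R.nonneg _ _ _, le_rfl]) hv
  simp only [Routing.load]
  rw [← Finset.mul_sum, Finset.sum_comm]
  have h1 : (P.card : ℝ) ≤ ∑ q ∈ (Finset.univ : Finset W).offDiag,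
      ∑ v ∈ S, (R.amount q.1 q.2).sum fun p a => if v ∈ p.support then a else 0 := by
    calc (P.card : ℝ) = ∑ q ∈ P, 1 := by simp
      _ ≤ _ := Finset.sum_le_sum hle
      _ ≤ _ := Finset.sum_le_sum_of_subset_of_nonneg hP fun q _ _ =>
        Finset.sum_nonneg fun v _ => Finset.sum_nonneg fun p _ => by
          dsimp only
          split_ifs
          exacts [R.nonneg _ _ _, le_rfl]
  linarith

open Classical in
theorem card_filter_same_class_le {W X : Type*} [Fintype W] (S : Finset W) (c : W → X)
    (h : ∀ m, 4 * (Finset.univ.filter fun v => v ∉ S ∧ c v = m).card ≤ 3 * Fintype.card W) :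
    4 * (Finset.univ.filter fun q : W × W => q.1 ∉ S ∧ q.2 ∉ S ∧ c q.1 = c q.2).card ≤
      3 * Fintype.card W ^ 2 := by
  have h1 : (Finset.univ.filter fun q : W × W => q.1 ∉ S ∧ q.2 ∉ S ∧ c q.1 = c q.2).card ≤
      ∑ u : W, (Finset.univ.filter fun v => v ∉ S ∧ c v = c u).card := by
    rw [← Finset.card_sigma]
    refine Finset.card_le_card_of_injOn (fun q => ⟨q.1, q.2⟩) ?_ ?_
    · intro q hq
      simp only [Finset.coe_filter, Finset.mem_univ, true_and, Set.mem_ofPred_eq] at hq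
      simp [hq.2.1, hq.2.2]
    · rintro ⟨a, b⟩ _ ⟨a', b'⟩ _ hab
      simpa using hab
  calc _ ≤ 4 * ∑ u : W, (Finset.univ.filter fun v => v ∉ S ∧ c v = c u).card :=
        Nat.mul_le_mul_left 4 h1
    _ = ∑ u : W, 4 * (Finset.univ.filter fun v => v ∉ S ∧ c v = c u).card := Finset.mul_sum ..
    _ ≤ ∑ _u : W, 3 * Fintype.card W := Finset.sum_le_sum fun u _ => h (c u)
    _ = 3 * Fintype.card W ^ 2 := by
      rw [Finset.sum_const, Finset.card_univ, smul_eq_mul]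
      ring

/-- The congestion of every routing in a plane graph with `N` vertices and radius at most `n` is at
least of order `N ^ 2 / n`. -/
theorem PlaneDrawing.exists_load_ge {W : Type*} [Fintype W] {H : SimpleGraph W}
    (D : PlaneDrawing H) (x₀ : W) (n : ℕ) (hwalk : ∀ u, ∃ p : H.Walk u x₀, p.length ≤ n)
    (hN : 8 < Fintype.card W) (R : Routing H) :
    ∃ v, (Fintype.card W : ℝ) ^ 2 / (16 * (2 * n + 8)) ≤ R.load v := by
  classical
  obtain ⟨S, c, hS, hc, hcard⟩ := D.exists_separator x₀ n hwalk
  set Q := Finset.univ.filter fun q : W × W => q.1 ∉ S ∧ q.2 ∉ S ∧ c q.1 = c q.2 with hQ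
  have hQcard := card_filter_same_class_le S c hcard
  set N := Fintype.card W with hNdef
  have hP := R.card_le_sum_load S (Finset.univ.offDiag \ Q) Finset.sdiff_subset fun q hq p => by
    refine exists_mem_support_of_ne hc p fun h => (Finset.mem_sdiff.1 hq).2 ?_
    simpa [hQ] using h
  have hPcard : (N : ℝ) ^ 2 / 8 < ((Finset.univ.offDiag \ Q).card : ℝ) := by
    have h1 := Finset.le_card_sdiff Q (Finset.univ.offDiag : Finset (W × W))
    rw [Finset.offDiag_card, Finset.card_univ, ← hNdef] at h1
    have h2 : N * N ≤ (Finset.univ.offDiag \ Q).card + Q.card + N := by omega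
    have h3 : (N : ℝ) * N ≤ (Finset.univ.offDiag \ Q).card + Q.card + N := by exact_mod_cast h2
    have h4 : 4 * (Q.card : ℝ) ≤ 3 * (N : ℝ) ^ 2 := by exact_mod_cast hQcard
    have h5 : (8 : ℝ) < N := by exact_mod_cast hN
    nlinarith
  by_contra! hlt
  have hN0 : (0 : ℝ) < N := by
    have : (8 : ℝ) < N := by exact_mod_cast hN
    linarith
  have hsum : ∑ v ∈ S, R.load v ≤ (N : ℝ) ^ 2 / 16 := by
    calc ∑ v ∈ S, R.load v ≤ ∑ _v ∈ S, (N : ℝ) ^ 2 / (16 * (2 * n + 8)) :=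
          Finset.sum_le_sum fun v _ => (hlt v).le
      _ = S.card * ((N : ℝ) ^ 2 / (16 * (2 * n + 8))) := by rw [Finset.sum_const, nsmul_eq_mul]
      _ ≤ (2 * n + 8) * ((N : ℝ) ^ 2 / (16 * (2 * n + 8))) := by
        gcongr
        exact_mod_cast hS
      _ = (N : ℝ) ^ 2 / 16 := by field_simp
  linarith

/-- Shortest paths from the root stay inside the ball. -/
theorem exists_walk_ballGraph {V : Type*} (G : SimpleGraph V) (x₀ : V) (n : ℕ)
    (h₀ : x₀ ∈ nodeBall G x₀ n) (u : nodeBall G x₀ n) :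
    ∃ p : (ballGraph G x₀ n).Walk u ⟨x₀, h₀⟩, p.length ≤ n := by
  classical
  have hu : G.edist x₀ u ≤ n := u.2
  obtain ⟨p, hp⟩ := G.exists_walk_of_edist_ne_top (ne_top_of_le_ne_top (ENat.natCast_ne_top n) hu)
  have hpn : p.length ≤ n := by
    rw [← hp] at hu
    exact_mod_cast hu
  have hmem : ∀ x ∈ p.support, x ∈ nodeBall G x₀ n := fun x hx =>
    (G.edist_le (p.takeUntil x hx)).trans
      (by exact_mod_cast (p.length_takeUntil_le_length hx).trans hpn)
  refine ⟨(p.induce _ hmem).reverse, ?_⟩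
  have h1 := congrArg List.length (p.support_induce hmem)
  rw [List.length_attachWith, SimpleGraph.Walk.length_support, SimpleGraph.Walk.length_support]
    at h1
  rw [SimpleGraph.Walk.length_reverse]
  omega

end CongestionPlanar

theorem mainTheorem1 {V : Type*} [Infinite V] (G : SimpleGraph V) (x₀ : V)
    [∀ n : ℕ, Fintype (CongestionPlanar.nodeBall G x₀ n)]
    (hplanar : CongestionPlanar.IsPlanar G)
    (hgrowth : CongestionPlanar.HasExponentialGrowth G x₀) :
    ∃ C : ℝ, 0 < C ∧ ∀ᶠ n : ℕ in atTop,
      ∀ R : CongestionPlanar.Routing (CongestionPlanar.ballGraph G x₀ n),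
        ∃ v : CongestionPlanar.nodeBall G x₀ n,
          C * ((CongestionPlanar.nodeBall G x₀ n).ncard : ℝ) ^ 2
            / Real.log ((CongestionPlanar.nodeBall G x₀ n).ncard : ℝ) ≤ R.load v := by
  obtain ⟨D⟩ := hplanar
  obtain ⟨n₀, lam, hlam, hgrow⟩ := hgrowth
  have hlog : 0 < Real.log lam := Real.log_pos hlam
  -- For `n ≥ 1` the denominator `16 * (2 * n + 8)` of the bound on the load is at most `160 * n`.
  refine ⟨Real.log lam / 160, by positivity, ?_⟩
  filter_upwards [eventually_ge_atTop n₀, eventually_ge_atTop 1,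
    (tendsto_pow_atTop_atTop_of_one_lt hlam).eventually_gt_atTop 8] with n hn hn1 hn8 R
  have hgn := hgrow n hn
  have hcard : (CongestionPlanar.nodeBall G x₀ n).ncard =
      Fintype.card (CongestionPlanar.nodeBall G x₀ n) := by
    rw [← Nat.card_coe_set_eq, Nat.card_eq_fintype_card]
  rw [hcard] at hgn ⊢
  have h₀ : x₀ ∈ CongestionPlanar.nodeBall G x₀ n := by
    simp [CongestionPlanar.nodeBall]
  obtain ⟨v, hv⟩ := (D.induce (CongestionPlanar.nodeBall G x₀ n)).exists_load_ge ⟨x₀, h₀⟩ n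
    (CongestionPlanar.exists_walk_ballGraph G x₀ n h₀) (by exact_mod_cast hn8.trans_le hgn) R
  refine ⟨v, le_trans ?_ hv⟩
  set N : ℝ := (Fintype.card (CongestionPlanar.nodeBall G x₀ n) : ℝ)
  have hn1' : (1 : ℝ) ≤ n := by exact_mod_cast hn1
  -- Exponential growth bounds the radius by a multiple of the logarithm of the size.
  have hradius : n * Real.log lam ≤ Real.log N := by
    rw [← Real.log_pow]
    exact Real.log_le_log (by positivity) hgn
  have hlogN : 0 < Real.log N := lt_of_lt_of_le (by positivity) hradius
  rw [div_le_div_iff₀ hlogN (by positivity)]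
  have : Real.log lam / 160 * (16 * (2 * n + 8)) ≤ Real.log N := by nlinarith
  nlinarith [mul_le_mul_of_nonneg_left this (sq_nonneg N)]
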